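/- Consider bin packing with general monotone submodular capacity constraints. An instance consists of $N$ jobs, a monotone submodular function $f:2^{[N]}\to\mathbb{R}_{\ge 0}$ with $f(\emptyset)=0$, and a capacity $V$ with $f(\{j\})\le V$ for every job $j$. A feasible solution is a partition of $[N]$ into nonempty sets $S$ (the loads of the machines used) with $f(S)\le V$ for each of them, and $\mathrm{OPT}$ is the smallest number of machines of a feasible solution. An algorithm knows $N$ and $V$ and accesses $f$ only through a value oracle, which returns $f(S)$ for a queried set $S\subseteq[N]$; it may be randomized. Each step of computation, each coin toss and each query counts as one step. Theorem. No polynomial-time algorithm can guarantee a factor better than $\sqrt{N}/\ln N$ from optimal. Precisely: let $\mathcal{A}$ be any (possibly randomized) value oracle algorithm, let $p$ be a polynomial with nonnegative integer coefficients, and let $\delta>0$. Then for all sufficiently large $N$ there is an instance with $N$ jobs, in which $V$ and all values of $f$ are integers in $\{0,1,\dots,N\}$, such that the probability that $\mathcal{A}$ outputs, within $p(N)$ steps, a feasible solution with fewer than $\frac{\sqrt{N}}{\ln N}\cdot\mathrm{OPT}$ machines is less than $\delta$. In particular, for every deterministic algorithm that always halts within $p(N)$ steps on such instances, and for all sufficiently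 large $N$, there is an instance on which its output is infeasible or uses at least $\frac{\sqrt{N}}{\ln N}\cdot\mathrm{OPT}$ machines. The computation between queries may be of any kind (each computation step may apply an arbitrary function to the configuration of the algorithm, and the algorithm may depend on $N$ in an arbitrary way). -/

import Mathlib

/-- An instance, with `N` jobs, of bin packing with monotone submodular capacity constraints:
a monotone submodular cost function on sets of jobs and a capacity common to all machines.
Each job fits on a machine of its own, so that a feasible packing exists. -/
structure SubmodularBinPacking (N : ℕ) where
  /-- the capacity cost of a set of jobs -/
  cost : Finset (Fin N) → ℝ
  /-- the capacity of every machine -/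
  capacity : ℝ
  cost_empty : cost ∅ = 0
  cost_mono : ∀ S T : Finset (Fin N), S ⊆ T → cost S ≤ cost T
  cost_submodular : ∀ S T : Finset (Fin N), cost (S ∪ T) + cost (S ∩ T) ≤ cost S + cost T
  job_fits : ∀ j : Fin N, cost {j} ≤ capacity

/-- A packing of `N` jobs is a partition of the set of jobs; its parts, which are nonempty by
the definition of `Finpartition`, are the sets of jobs placed on the machines that are used. -/
abbrev JobPacking (N : ℕ) : Type := Finpartition (Finset.univ : Finset (Fin N))

/-- The number of machines that a packing uses. -/
def JobPacking.machines {N : ℕ} (P : JobPacking N) : ℕ := P.parts.card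

namespace SubmodularBinPacking

variable {N : ℕ}

/-- A packing is feasible if every machine respects the capacity. -/
def Feasible (I : SubmodularBinPacking N) (P : JobPacking N) : Prop :=
  ∀ S ∈ P.parts, I.cost S ≤ I.capacity

/-- The minimum number of machines of a feasible packing. -/
noncomputable def opt (I : SubmodularBinPacking N) : ℕ :=
  sInf {k : ℕ | ∃ P : JobPacking N, I.Feasible P ∧ P.machines = k}

/-- Some feasible packing exists, and the minimum defining `opt` is attained. -/
theorem exists_feasible_machines_eq_opt (I : SubmodularBinPacking N) :
    ∃ P : JobPacking N, I.Feasible P ∧ P.machines = I.opt := by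
  have hne : {k : ℕ | ∃ P : JobPacking N, I.Feasible P ∧ P.machines = k}.Nonempty := by
    refine ⟨_, (⊥ : JobPacking N), ?_, rfl⟩
    intro S hS
    obtain ⟨j, -, rfl⟩ := Finpartition.mem_bot_iff.1 hS
    exact I.job_fits j
  exact Nat.sInf_mem hne

end SubmodularBinPacking

/-- What a randomized algorithm with a value oracle does in one step, when its current
configuration is given. -/
inductive OracleStep (N : ℕ) (σ : Type) : Type
  /-- stop and output a packing -/
  | halt (P : JobPacking N)
  /-- one step of internal computation -/
  | compute (next : σ)
  /-- toss a fair coin -/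
  | toss (heads tails : σ)
  /-- ask the oracle for the value of the cost function at the set `S` -/
  | query (S : Finset (Fin N)) (next : ℝ → σ)

/-- A randomized algorithm with a value oracle, for instances with `N` jobs. It is started with
the capacity, and learns about the cost function by oracle queries only. The transition function
is arbitrary, so the model contains the probabilistic oracle Turing machines and random access
machines (with their own configurations and their own steps), in uniform and nonuniform
versions. A deterministic algorithm is one that never tosses a coin. -/
structure OracleMachine (N : ℕ) where
  /-- the configurations -/
  Config : Type
  /-- the initial configuration, which depends on the capacity -/
  start : ℝ → Config
  /-- the step to be taken -/
  step : Config → OracleStep N Config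

namespace OracleMachine

variable {N : ℕ}

open Classical in
/-- The probability that the machine `M`, when it is in configuration `s` and its queries are
answered by the function `f`, halts after at most `t` further steps with an output that has the
property `good`. Here a step of internal computation, a coin toss, and an oracle query each
count as one step. -/
noncomputable def probFrom (M : OracleMachine N) (f : Finset (Fin N) → ℝ)
    (good : JobPacking N → Prop) : ℕ → M.Config → ℝ
  | 0, s =>
    match M.step s with
    | .halt P => if good P then 1 else 0
    | .compute _ => 0
    | .toss _ _ => 0
    | .query _ _ => 0
  | t + 1, s =>
    match M.step s with
    | .halt P => if good P then 1 else 0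
    | .compute s' => M.probFrom f good t s'
    | .toss s₀ s₁ => (M.probFrom f good t s₀ + M.probFrom f good t s₁) / 2
    | .query S next => M.probFrom f good t (next (f S))

/-- The probability that the machine `M`, run on the instance `I`, outputs within `t` steps a
feasible packing that uses fewer than `ρ` times the optimal number of machines. -/
noncomputable def successProb (M : OracleMachine N) (I : SubmodularBinPacking N) (t : ℕ)
    (ρ : ℝ) : ℝ :=
  M.probFrom I.cost (fun P => I.Feasible P ∧ (P.machines : ℝ) < ρ * (I.opt : ℝ)) t
    (M.start I.capacity)

end OracleMachine

/-! Hide a uniformly random set `A` in `hiddenCost`, with capacity `b = ⌊√N⌋`. The parts `A` and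
`Aᶜ` are feasible, so two machines suffice. Yet the cost of `S` differs from `min (b + 1) |S|` only
if `|S| > b` and `A` does not split `S` (`hiddenCost_eq_or`), which happens for at most a fraction
`2 ^ (-b)` of the sets `A`. A query thus reveals something with at most this probability. A packing
with fewer than `N / b` machines has a part larger than `b`, so it too is feasible for at most this
fraction. By `sum_probFrom_le`, the average success probability within `t` steps is at most `(t + 1)
* 2 ^ (-b)`, and `2 ^ √N` outgrows every polynomial. -/

/-- Truncation preserves the submodular inequality of a monotone function. -/
theorem min_add_min_le_of_submodular {c s t u i : ℕ} (h : u + i ≤ s + t) (hsu : s ≤ u)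
    (htu : t ≤ u) (his : i ≤ s) (hit : i ≤ t) : min c u + min c i ≤ min c s + min c t := by
  omega

/-- The cost function that hides the set `A`: up to `b + 1`, it counts the jobs, but neither in
`A` nor outside `A` more than `b` of them. -/
def hiddenCost {N : ℕ} (A : Finset (Fin N)) (b : ℕ) (S : Finset (Fin N)) : ℕ :=
  min (b + 1) (min b (S ∩ A).card + min b (S \ A).card)

theorem hiddenCost_mono {N : ℕ} (A : Finset (Fin N)) (b : ℕ) {S T : Finset (Fin N)}
    (h : S ⊆ T) : hiddenCost A b S ≤ hiddenCost A b T := by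
  have h₁ := Finset.card_le_card (Finset.inter_subset_inter_right (u := A) h)
  have h₂ := Finset.card_le_card (Finset.sdiff_subset_sdiff h (le_refl A))
  unfold hiddenCost
  omega

/-- Cardinality of the trace on a fixed set is modular and monotone. Truncating each trace, adding,
and truncating again keeps submodularity and monotonicity. -/
theorem hiddenCost_submodular {N : ℕ} (A : Finset (Fin N)) (b : ℕ) (S T : Finset (Fin N)) :
    hiddenCost A b (S ∪ T) + hiddenCost A b (S ∩ T) ≤ hiddenCost A b S + hiddenCost A b T := by
  have key : ∀ S T B : Finset (Fin N),
      min b ((S ∪ T) ∩ B).card + min b ((S ∩ T) ∩ B).card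
        ≤ min b (S ∩ B).card + min b (T ∩ B).card := by
    intro S T B
    apply min_add_min_le_of_submodular
    · rw [Finset.union_inter_distrib_right, Finset.inter_inter_distrib_right,
        Finset.card_union_add_card_inter]
    all_goals exact Finset.card_le_card (by grind)
  have mono : ∀ {S T : Finset (Fin N)} (B : Finset (Fin N)), S ⊆ T →
      min b (S ∩ B).card ≤ min b (T ∩ B).card := fun B h =>
    min_le_min_left b (Finset.card_le_card (Finset.inter_subset_inter_right h))
  unfold hiddenCost
  simp only [Finset.sdiff_eq_inter_compl]
  have h₁ := key S T A
  have h₂ := key S T Aᶜ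
  apply min_add_min_le_of_submodular
  · omega
  · exact add_le_add (mono A Finset.subset_union_left) (mono Aᶜ Finset.subset_union_left)
  · exact add_le_add (mono A Finset.subset_union_right) (mono Aᶜ Finset.subset_union_right)
  · exact add_le_add (mono A Finset.inter_subset_left) (mono Aᶜ Finset.inter_subset_left)
  · exact add_le_add (mono A Finset.inter_subset_right) (mono Aᶜ Finset.inter_subset_right)

/-- The hidden set can only be noticed through large sets that it does not split. -/
theorem hiddenCost_eq_or {N : ℕ} (A : Finset (Fin N)) {b : ℕ} (hb : 1 ≤ b) (S : Finset (Fin N)) :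
    hiddenCost A b S = min (b + 1) S.card ∨ b < S.card ∧ (S ⊆ A ∨ S ⊆ Aᶜ) := by
  have hcard := Finset.card_inter_add_card_sdiff S A
  by_cases h₁ : (S ∩ A).card = 0
  · have h : S ⊆ Aᶜ := by
      rw [Finset.card_eq_zero] at h₁
      exact Finset.subset_compl_iff_disjoint_right.2 (Finset.disjoint_iff_inter_eq_empty.2 h₁)
    unfold hiddenCost
    by_cases hb : b < S.card
    · exact Or.inr ⟨hb, Or.inr h⟩
    · omega
  by_cases h₂ : (S \ A).card = 0
  · have h : S ⊆ A := by
      rwa [Finset.card_eq_zero, Finset.sdiff_eq_empty_iff_subset] at h₂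
    unfold hiddenCost
    by_cases hb : b < S.card
    · exact Or.inr ⟨hb, Or.inl h⟩
    · omega
  -- Both sides of `S` are nonempty: if one is truncated to `b`, the other still adds at least 1,
  -- and the sum reaches the outer truncation `b + 1`.
  · left
    unfold hiddenCost
    omega

theorem card_filter_subset_or_subset_compl_le {N b : ℕ} {S : Finset (Fin N)}
    (hS : b < S.card) :
    (Finset.univ.filter fun A : Finset (Fin N) => S ⊆ A ∨ S ⊆ Aᶜ).card ≤ 2 ^ (N - b) := by
  have hN : S.card ≤ N := by simpa using Finset.card_le_univ S
  have hsub : (Finset.univ.filter fun A : Finset (Fin N) => S ⊆ A ∨ S ⊆ Aᶜ)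
      ⊆ Finset.Icc S Finset.univ ∪ Sᶜ.powerset := by
    intro A hA
    simp only [Finset.mem_filter, Finset.mem_univ, true_and] at hA
    simp only [Finset.mem_union, Finset.mem_Icc, Finset.mem_powerset]
    exact hA.imp (fun h => ⟨h, Finset.subset_univ A⟩) fun h => Finset.subset_compl_comm.1 h
  -- Since `|S| ≥ b + 1`, the spare factor 2 pays for the two alternatives.
  have hpow : 2 ^ (N - S.card) ≤ 2 ^ (N - b - 1) := Nat.pow_le_pow_right two_pos (by omega)
  calc _ ≤ _ := Finset.card_le_card hsub
    _ ≤ _ := Finset.card_union_le _ _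
    _ = 2 ^ (N - S.card) + 2 ^ (N - S.card) := by
      rw [Finset.card_Icc_finset (Finset.subset_univ S), Finset.card_powerset,
        Finset.card_compl, Finset.card_univ, Fintype.card_fin]
    _ ≤ 2 ^ (N - b - 1) * 2 := by omega
    _ = 2 ^ (N - b) := by rw [← pow_succ]; congr 1; omega

/-- The instance of capacity `b` that hides the set `A`. -/
def hiddenInstance {N : ℕ} (A : Finset (Fin N)) (b : ℕ) (hb : 1 ≤ b) :
    SubmodularBinPacking N where
  cost S := hiddenCost A b S
  capacity := b
  cost_empty := by simp [hiddenCost]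
  cost_mono S T h := by exact_mod_cast hiddenCost_mono A b h
  cost_submodular S T := by exact_mod_cast hiddenCost_submodular A b S T
  job_fits j := by
    have h := Finset.card_inter_add_card_sdiff {j} A
    rw [Finset.card_singleton] at h
    have : hiddenCost A b {j} ≤ b := by
      unfold hiddenCost
      omega
    exact_mod_cast this

theorem hiddenInstance_opt_le_two {N : ℕ} (A : Finset (Fin N)) (b : ℕ) (hb : 1 ≤ b) :
    (hiddenInstance A b hb).opt ≤ 2 := by
  classical
  have hdisj : Disjoint A Aᶜ := disjoint_compl_right
  -- Erasing `∅` covers the cases where `A` is empty or everything.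
  let P : JobPacking N := Finpartition.ofErase {A, Aᶜ}
    (by
      rw [Finset.supIndep_iff_pairwiseDisjoint]
      intro S hS T hT hne
      simp only [Finset.coe_insert, Finset.coe_singleton, Set.mem_insert_iff,
        Set.mem_singleton_iff] at hS hT
      rcases hS with rfl | rfl <;> rcases hT with rfl | rfl
      · exact absurd rfl hne
      · exact hdisj
      · exact hdisj.symm
      · exact absurd rfl hne)
    (by simp)
  have hP : P.parts ⊆ {A, Aᶜ} := Finset.erase_subset _ _
  have hfeas : (hiddenInstance A b hb).Feasible P := by
    intro S hS
    have hcost : hiddenCost A b S ≤ b := by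
      have h := hP hS
      simp only [Finset.mem_insert, Finset.mem_singleton] at h
      unfold hiddenCost
      rcases h with rfl | rfl
      · simp
      · have : (Aᶜ ∩ A).card = 0 := by
          rw [Finset.card_eq_zero, ← Finset.disjoint_iff_inter_eq_empty]
          exact hdisj.symm
        omega
    show ((hiddenCost A b S : ℕ) : ℝ) ≤ (b : ℝ)
    exact_mod_cast hcost
  calc (hiddenInstance A b hb).opt ≤ P.parts.card := Nat.sInf_le ⟨P, hfeas, rfl⟩
    _ ≤ ({A, Aᶜ} : Finset (Finset (Fin N))).card := Finset.card_le_card hP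
    _ ≤ 2 := Finset.card_le_two

/-- A packing with few machines has a large part. -/
theorem JobPacking.exists_lt_card_of_machines_mul_lt {N b : ℕ} (P : JobPacking N)
    (h : P.machines * b < N) : ∃ S ∈ P.parts, b < S.card := by
  by_contra! hle
  have h₁ := Finset.sum_le_card_nsmul P.parts Finset.card b hle
  rw [P.sum_card_parts, Finset.card_univ, Fintype.card_fin, smul_eq_mul] at h₁
  exact absurd h (not_lt.2 h₁)

/-! ### Averaging over the hidden set -/

namespace OracleMachine

variable {N : ℕ}

theorem probFrom_mem_Icc (M : OracleMachine N) (f : Finset (Fin N) → ℝ)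
    (good : JobPacking N → Prop) (t : ℕ) (s : M.Config) :
    M.probFrom f good t s ∈ Set.Icc (0 : ℝ) 1 := by
  induction t generalizing s with
  | zero =>
    unfold probFrom
    split
    · split_ifs <;> simp
    all_goals simp
  | succ t ih =>
    unfold probFrom
    split
    · split_ifs <;> simp
    · exact ih _
    · rename_i s₀ s₁ _
      have h₀ := ih s₀
      have h₁ := ih s₁
      simp only [Set.mem_Icc] at h₀ h₁ ⊢
      constructor <;> linarith
    · exact ih _

open Classical in
/-- If every query reveals a difference between the members of a family of oracles and a fixed
reference oracle for at most `K` members only, and every output is good for at most `K` members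
only, then the success probabilities within `t` steps add up to at most `(t + 1) * K`. -/
theorem sum_probFrom_le {ι : Type*} [Fintype ι] (M : OracleMachine N)
    (f : ι → Finset (Fin N) → ℝ) (g : Finset (Fin N) → ℝ) (good : ι → JobPacking N → Prop)
    (K : ℝ) (hK : 0 ≤ K)
    (hquery : ∀ S, ((Finset.univ.filter fun i => f i S ≠ g S).card : ℝ) ≤ K)
    (hgood : ∀ P, ((Finset.univ.filter fun i => good i P).card : ℝ) ≤ K)
    (t : ℕ) (s : M.Config) :
    ∑ i, M.probFrom (f i) (good i) t s ≤ (t + 1) * K := by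
  have hhalt : ∀ P, ∑ i, (if good i P then (1 : ℝ) else 0) ≤ K := fun P => by
    rw [Finset.sum_boole]
    exact hgood P
  induction t generalizing s with
  | zero =>
    unfold probFrom
    split
    · simpa using hhalt _
    all_goals simpa using hK
  | succ t ih =>
    have hle : ((t : ℝ) + 1) * K ≤ ((t + 1 : ℕ) + 1) * K := by push_cast; nlinarith
    unfold probFrom
    split
    · refine (hhalt _).trans ?_
      push_cast
      nlinarith [mul_nonneg (Nat.cast_nonneg (α := ℝ) t) hK]
    · exact (ih _).trans hle
    · rename_i s₀ s₁ _
      rw [← Finset.sum_div, Finset.sum_add_distrib]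
      linarith [ih s₀, ih s₁]
    · rename_i S next _
      -- Members that agree with `g` at `S` all move to the same configuration; each of the others
      -- costs at most 1.
      have hterm : ∀ i, M.probFrom (f i) (good i) t (next (f i S))
          ≤ M.probFrom (f i) (good i) t (next (g S)) + if f i S ≠ g S then 1 else 0 := by
        intro i
        split_ifs with h
        · linarith [(M.probFrom_mem_Icc (f i) (good i) t (next (f i S))).2,
            (M.probFrom_mem_Icc (f i) (good i) t (next (g S))).1]
        · rw [not_not.1 h, add_zero]
      calc _ ≤ ∑ i, (M.probFrom (f i) (good i) t (next (g S))
            + if f i S ≠ g S then (1 : ℝ) else 0) := Finset.sum_le_sum fun i _ => hterm i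
        _ = ∑ i, M.probFrom (f i) (good i) t (next (g S))
            + ((Finset.univ.filter fun i => f i S ≠ g S).card : ℝ) := by
          rw [Finset.sum_add_distrib, Finset.sum_boole]
        _ ≤ (t + 1) * K + K := add_le_add (ih _) (hquery S)
        _ = _ := by push_cast; ring

/-- Some hidden set makes the machine fail with probability close to one. -/
theorem exists_successProb_hiddenInstance_lt (M : OracleMachine N) (b t : ℕ) (hb : 1 ≤ b)
    (hbN : b ≤ N) {ρ δ : ℝ} (hρ₀ : 0 ≤ ρ) (hρ : 2 * ρ * b ≤ N)
    (hδ : ((t : ℝ) + 1) * (1 / 2) ^ b < δ) :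
    ∃ A : Finset (Fin N), M.successProb (hiddenInstance A b hb) t ρ < δ := by
  classical
  have hsum := M.sum_probFrom_le (fun A : Finset (Fin N) => (hiddenInstance A b hb).cost)
    (fun S => ((min (b + 1) S.card : ℕ) : ℝ))
    (fun A P => (hiddenInstance A b hb).Feasible P ∧
      (P.machines : ℝ) < ρ * ((hiddenInstance A b hb).opt : ℝ))
    (2 ^ (N - b)) (by positivity) ?_ ?_ t (M.start b)
  · obtain ⟨A, -, hA⟩ := Finset.exists_lt_of_sum_lt (s := Finset.univ)
      (f := fun A : Finset (Fin N) => M.successProb (hiddenInstance A b hb) t ρ)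
      (g := fun _ => δ) (by
        refine lt_of_le_of_lt hsum ?_
        rw [Finset.sum_const, Finset.card_univ, Fintype.card_finset, Fintype.card_fin,
          nsmul_eq_mul]
        have hpow : (2 : ℝ) ^ (N - b) = 2 ^ N * (1 / 2) ^ b := by
          rw [pow_sub₀ _ two_ne_zero hbN, one_div, inv_pow]
        rw [hpow]
        push_cast
        calc ((t : ℝ) + 1) * (2 ^ N * (1 / 2) ^ b) = 2 ^ N * (((t : ℝ) + 1) * (1 / 2) ^ b) := by
              ring
          _ < 2 ^ N * δ := by gcongr)
    exact ⟨A, hA⟩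
  · intro S
    by_cases hS : b < S.card
    · refine le_trans ?_ (Nat.cast_le.2 (card_filter_subset_or_subset_compl_le hS)) |>.trans
        (by norm_num)
      refine Nat.cast_le.2 (Finset.card_le_card (Finset.monotone_filter_right _ ?_))
      intro A _ hA
      rcases hiddenCost_eq_or A hb S with h | h
      · exact absurd (congrArg (Nat.cast (R := ℝ)) h) hA
      · exact h.2
    · rw [Finset.filter_false_of_mem]
      · simp
      · intro A _ hA
        rcases hiddenCost_eq_or A hb S with h | h
        · exact hA (congrArg (Nat.cast (R := ℝ)) h)
        · exact hS h.1
  · intro P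
    by_cases hP : P.machines * b < N
    · obtain ⟨S, hSP, hS⟩ := P.exists_lt_card_of_machines_mul_lt hP
      refine le_trans ?_ (Nat.cast_le.2 (card_filter_subset_or_subset_compl_le hS)) |>.trans
        (by norm_num)
      refine Nat.cast_le.2 (Finset.card_le_card fun A hmem => ?_)
      simp only [Finset.mem_filter, Finset.mem_univ, true_and] at hmem ⊢
      obtain ⟨hA, -⟩ := hmem
      have hcost : hiddenCost A b S ≤ b := Nat.cast_le (α := ℝ).1 (hA S hSP)
      rcases hiddenCost_eq_or A hb S with h | h
      · omega
      · exact h.2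
    -- With at least `N / b` machines the output is good for no `A`, because `ρ * opt * b ≤ 2 * ρ *
    -- b ≤ N`.
    · refine le_of_eq_of_le (b := 0) ?_ (by positivity)
      rw [Nat.cast_eq_zero, Finset.card_eq_zero, Finset.eq_empty_iff_forall_notMem]
      intro A hmem
      simp only [Finset.mem_filter, Finset.mem_univ, true_and] at hmem
      obtain ⟨-, hA⟩ := hmem
      apply hP
      have hopt : ((hiddenInstance A b hb).opt : ℝ) ≤ 2 := by
        exact_mod_cast hiddenInstance_opt_le_two A b hb
      have hb₀ : (0 : ℝ) < b := by exact_mod_cast hb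
      have h : (P.machines : ℝ) * b < N :=
        calc (P.machines : ℝ) * b
            < ρ * ((hiddenInstance A b hb).opt : ℝ) * b := by gcongr
          _ ≤ ρ * 2 * b := by gcongr
          _ ≤ N := by linarith
      exact_mod_cast h

end OracleMachine

/-! ### Asymptotics and choice of parameters -/

theorem Polynomial.tendsto_eval_mul_half_pow (p : Polynomial ℕ) :
    Filter.Tendsto (fun n : ℕ => ((p.eval n : ℕ) : ℝ) * (1 / 2) ^ n) Filter.atTop (nhds 0) := by
  induction p using Polynomial.induction_on' with
  | add p q hp hq => simpa [add_mul] using hp.add hq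
  | monomial k a =>
    have h := (tendsto_pow_const_mul_const_pow_of_abs_lt_one k
      (r := (1 / 2 : ℝ)) (by rw [abs_of_pos] <;> norm_num)).const_mul (a : ℝ)
    simpa [mul_assoc] using h

theorem Polynomial.eval_nat_mono (p : Polynomial ℕ) : Monotone fun n : ℕ => p.eval n := by
  intro m n h
  simp only [Polynomial.eval_eq_sum_range]
  gcongr

theorem Nat.tendsto_sqrt_atTop : Filter.Tendsto Nat.sqrt Filter.atTop Filter.atTop :=
  Filter.tendsto_atTop_atTop.2 fun b => ⟨b * b, fun _ h => Nat.le_sqrt.2 h⟩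

theorem Polynomial.eventually_eval_add_one_mul_half_pow_sqrt_lt (p : Polynomial ℕ) {δ : ℝ}
    (hδ : 0 < δ) :
    ∀ᶠ N : ℕ in Filter.atTop, (((p.eval N : ℕ) : ℝ) + 1) * (1 / 2) ^ N.sqrt < δ := by
  -- As `N ≤ (⌊√N⌋ + 1) ^ 2`, a polynomial in `N` is bounded by one in `⌊√N⌋`.
  have h := ((p.comp ((Polynomial.X + 1) ^ 2) + 1).tendsto_eval_mul_half_pow.comp
    Nat.tendsto_sqrt_atTop).eventually (gt_mem_nhds hδ)
  filter_upwards [h] with N hN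
  refine lt_of_le_of_lt ?_ hN
  have hle : p.eval N ≤ p.eval ((N.sqrt + 1) ^ 2) :=
    p.eval_nat_mono (by rw [sq]; exact (Nat.lt_succ_sqrt N).le)
  have hle' : ((p.eval N : ℕ) : ℝ) ≤ ((p.eval ((N.sqrt + 1) ^ 2) : ℕ) : ℝ) := by
    exact_mod_cast hle
  simp only [Function.comp_apply, Polynomial.eval_add, Polynomial.eval_comp, Polynomial.eval_pow,
    Polynomial.eval_X, Polynomial.eval_one]
  rw [Nat.cast_add, Nat.cast_one]
  gcongr

theorem mainTheorem8 (A : (N : ℕ) → OracleMachine N) (p : Polynomial ℕ) (δ : ℝ) (hδ : 0 < δ) :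
    ∀ᶠ N : ℕ in Filter.atTop,
      ∃ I : SubmodularBinPacking N,
        (∃ k : ℕ, k ≤ N ∧ I.capacity = (k : ℝ)) ∧
        (∀ S : Finset (Fin N), ∃ k : ℕ, k ≤ N ∧ I.cost S = (k : ℝ)) ∧
        (A N).successProb I (p.eval N) (Real.sqrt (N : ℝ) / Real.log (N : ℝ)) < δ := by
  have hlog : ∀ᶠ N : ℕ in Filter.atTop, 2 ≤ Real.log (N : ℝ) :=
    (Real.tendsto_log_atTop.comp tendsto_natCast_atTop_atTop).eventually_ge_atTop 2
  filter_upwards [p.eventually_eval_add_one_mul_half_pow_sqrt_lt hδ, hlog,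
    Filter.eventually_ge_atTop 4] with N hN hlogN hN4
  have hb : 2 ≤ N.sqrt := Nat.le_sqrt.2 hN4
  have hbN : N.sqrt + 1 ≤ N := by nlinarith [Nat.sqrt_le N]
  have hsqrt : (N.sqrt : ℝ) ≤ Real.sqrt N := Real.nat_sqrt_le_real_sqrt
  -- The logarithm is only needed to absorb the factor 2 from the optimum.
  have hρ : 2 * (Real.sqrt N / Real.log N) ≤ Real.sqrt N := by
    rw [← mul_div_assoc, div_le_iff₀ (by linarith)]
    nlinarith [Real.sqrt_nonneg (N : ℝ)]
  obtain ⟨A₀, hA₀⟩ := (A N).exists_successProb_hiddenInstance_lt N.sqrt (p.eval N) (by omega)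
    (by omega) (ρ := Real.sqrt N / Real.log N) (by positivity)
    (calc 2 * (Real.sqrt N / Real.log N) * N.sqrt ≤ Real.sqrt N * Real.sqrt N := by gcongr
      _ = N := Real.mul_self_sqrt (Nat.cast_nonneg N)) hN
  exact ⟨hiddenInstance A₀ N.sqrt (by omega), ⟨N.sqrt, by omega, rfl⟩,
    fun S => ⟨hiddenCost A₀ N.sqrt S, (min_le_left _ _).trans hbN, rfl⟩, hA₀⟩
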